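/- An \emph{ordered graph} is a finite simple graph together with a linear order on its vertex set; if it has $n$ vertices, its vertex set is identified with $[n]=\{1,\dots,n\}$ through the order. Thus an ordered graph on $[n]$ is a graph with vertex set $[n]$, and two ordered graphs are equal when the order-preserving bijection between their vertex sets is a graph isomorphism. For an ordered graph $G$ and a vertex $v$, let $G-v$ be the ordered graph induced by $G$ on $V(G)\setminus\{v\}$ with the inherited order. The \emph{shadow} of $G$ is $\partial G=\{G-v : v\in V(G)\}$, and the shadow of a collection $\mathcal{G}$ of ordered graphs is $\partial\mathcal{G}=\bigcup_{G\in\mathcal{G}}\partial G$. Theorem. Let $n\in\mathbb{N}$ with $n\geq 136$, and let $\mathcal{G}$ be a collection of ordered graphs on $[n]$. If $|\mathcal{G}|<n$, then $|\partial\mathcal{G}|\geq|\mathcal{G}|$. -/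

import Mathlib

/-- An ordered graph on `n` vertices: its vertex set is identified, through the order, with
`Fin n`, so that it is a simple graph on `Fin n` and isomorphic ordered graphs are equal. -/
abbrev OrderedGraph (n : ℕ) : Type := SimpleGraph (Fin n)

namespace OrderedGraph

/-- The ordered graph `G[U]` induced by `G` on a set `U` of `k` vertices, with the inherited order:
the vertex `i` of `G[U]` is the `i`-th smallest element of `U`. -/
def induced {n k : ℕ} (G : OrderedGraph n) (U : Finset (Fin n)) (hU : U.card = k) :
    OrderedGraph k :=
  SimpleGraph.comap (U.orderEmbOfFin hU) G

/-- The complement of a vertex of `Fin n` has `n - 1` elements. -/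
theorem card_erase_vertex {n : ℕ} (v : Fin n) :
    ((Finset.univ : Finset (Fin n)).erase v).card = n - 1 := by
  simp

/-- The ordered graph `G - v = G[V(G) \ {v}]`. -/
def deleteVertex {n : ℕ} (G : OrderedGraph n) (v : Fin n) : OrderedGraph (n - 1) :=
  induced G ((Finset.univ : Finset (Fin n)).erase v) (card_erase_vertex v)

/-- The shadow `∂G` of an ordered graph: all the ordered graphs `G - v`. -/
def shadow {n : ℕ} (G : OrderedGraph n) : Set (OrderedGraph (n - 1)) :=
  {H | ∃ v : Fin n, H = deleteVertex G v}

/-- The shadow `∂𝒢` of a collection of ordered graphs: the union of the shadows `∂G`, `G ∈ 𝒢`. -/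
def familyShadow {n : ℕ} (𝒢 : Set (OrderedGraph n)) : Set (OrderedGraph (n - 1)) :=
  ⋃ G ∈ 𝒢, shadow G

end OrderedGraph

/-!
Colour the vertices. A family `A` of coloured ordered graphs on `k + 2` vertices showing `q`
colours satisfies `min |A| (k + q) ≤ |∂A|`, by induction on `k`: splitting off the last vertex,
and recording its adjacencies in the colours of the other vertices, sorts `A` by the last colour
`c` into families `A_c` with links `F_c` on one vertex fewer, and the shadows of the `F_c` embed
disjointly into `∂A`. If every `F_c` is small enough for the induction hypothesis to give
`|F_c| ≤ |∂F_c|`, summing over `c` gives `|A| ≤ |∂A|`. Otherwise one `A_c` alone has a shadow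
exceeding its number of colours by `k`, because deleting the last vertex loses no graph of `F_c`
unless it merges colours. This excess passes from `A_c` to `A`, since each new colour forces a
new graph in the shadow: deleting vertices of different colours gives different graphs. Ordered
graphs are the case of a single colour.
-/

/-- An ordered graph on `n` vertices whose vertices are coloured by `α`. Colours remember the
adjacencies to the vertices that have been split off, which makes induction on `n` possible. -/
@[ext]
structure ColoredGraph (n : ℕ) (α : Type*) where
  color : Fin n → α
  graph : OrderedGraph n

namespace ColoredGraph

open Finset

noncomputable section

variable {n : ℕ} {α β : Type*}

instance : DecidableEq (ColoredGraph n α) :=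
  Classical.decEq _

/-- The coloured ordered graph `x - v`, with the inherited order and colours. -/
def deleteVertex (x : ColoredGraph (n + 1) α) (v : Fin (n + 1)) : ColoredGraph n α where
  color := x.color ∘ v.succAbove
  graph := x.graph.comap v.succAbove

/-- The shadow `∂x` of a coloured ordered graph. -/
def shadow (x : ColoredGraph (n + 1) α) : Finset (ColoredGraph n α) :=
  univ.image x.deleteVertex

/-- The shadow `∂A` of a finite family of coloured ordered graphs. -/
def familyShadow (A : Finset (ColoredGraph (n + 1) α)) : Finset (ColoredGraph n α) :=
  A.biUnion shadow

theorem deleteVertex_mem_familyShadow {A : Finset (ColoredGraph (n + 1) α)}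
    {x : ColoredGraph (n + 1) α} (hx : x ∈ A) (v : Fin (n + 1)) :
    x.deleteVertex v ∈ familyShadow A :=
  mem_biUnion.2 ⟨x, hx, mem_image_of_mem _ (mem_univ v)⟩

theorem mem_familyShadow {A : Finset (ColoredGraph (n + 1) α)} {y : ColoredGraph n α} :
    y ∈ familyShadow A ↔ ∃ x ∈ A, ∃ v, x.deleteVertex v = y := by
  simp [familyShadow, shadow]

theorem familyShadow_nonempty {A : Finset (ColoredGraph (n + 1) α)} (hA : A.Nonempty) :
    (familyShadow A).Nonempty :=
  hA.elim fun _ hx => ⟨_, deleteVertex_mem_familyShadow hx 0⟩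

theorem color_eq_of_deleteVertex_eq (x : ColoredGraph (n + 1) α) {v w : Fin (n + 1)}
    (h : x.deleteVertex v = x.deleteVertex w) : x.color v = x.color w := by
  have sum_eq (u : Fin (n + 1)) : ({x.color u} : Multiset α) + ∑ i, {(x.deleteVertex u).color i} =
      ∑ i, {x.color i} :=
    (Fin.sum_univ_succAbove (fun i => ({x.color i} : Multiset α)) u).symm
  have hsum := (sum_eq v).trans (sum_eq w).symm
  rw [h] at hsum
  exact Multiset.singleton_inj.1 (add_right_cancel hsum)

/-- Recolouring of the vertices along `f`. -/
def map (f : α → β) (x : ColoredGraph n α) : ColoredGraph n β where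
  color := f ∘ x.color
  graph := x.graph

/-- The colour of the last vertex. -/
def lastColor (x : ColoredGraph (n + 1) α) : α :=
  x.color (Fin.last n)

open Classical in
/-- The graph on the vertices other than the last one, where the colour of each vertex also records
whether it is adjacent to the last vertex. -/
def init (x : ColoredGraph (n + 1) α) : ColoredGraph n (α × Bool) where
  color i := (x.color i.castSucc, decide (x.graph.Adj i.castSucc (Fin.last n)))
  graph := x.graph.comap Fin.castSucc

theorem map_fst_init (x : ColoredGraph (n + 1) α) :
    x.init.map Prod.fst = x.deleteVertex (Fin.last n) := by
  simp only [map, init, deleteVertex, Fin.succAbove_last]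
  rfl

theorem lastColor_deleteVertex_castSucc (x : ColoredGraph (n + 2) α) (v : Fin (n + 1)) :
    (x.deleteVertex v.castSucc).lastColor = x.lastColor := by
  simp [deleteVertex, lastColor]

theorem init_deleteVertex_castSucc (x : ColoredGraph (n + 2) α) (v : Fin (n + 1)) :
    (x.deleteVertex v.castSucc).init = x.init.deleteVertex v := by
  refine ColoredGraph.ext (funext fun i => Prod.ext ?_ (decide_eq_decide.2 ?_)) ?_
  · simp [init, deleteVertex]
  · simp [deleteVertex]
  · ext
    simp [init, deleteVertex]

theorem eq_of_lastColor_eq_of_init_eq {x y : ColoredGraph (n + 1) α}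
    (hlast : x.lastColor = y.lastColor) (hinit : x.init = y.init) : x = y := by
  obtain ⟨hcolor, hgraph⟩ := ColoredGraph.mk.inj hinit
  have color_castSucc (i : Fin n) := congrArg Prod.fst (congrFun hcolor i)
  have adj_last (i : Fin n) := decide_eq_decide.1 (congrArg Prod.snd (congrFun hcolor i))
  have adj_castSucc (i j : Fin n) := iff_of_eq (congrFun₂ (congrArg SimpleGraph.Adj hgraph) i j)
  ext i j
  · exact congrFun (funext (Fin.lastCases hlast color_castSucc)) i
  · cases i using Fin.lastCases with
    | last =>
      cases j using Fin.lastCases with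
      | last => simp
      | cast j => simpa only [SimpleGraph.adj_comm] using adj_last j
    | cast i =>
      cases j using Fin.lastCases with
      | last => exact adj_last i
      | cast j => exact adj_castSucc i j

variable [DecidableEq α]

/-- The set of colours that a coloured ordered graph shows. -/
def colors (x : ColoredGraph n α) : Finset α :=
  univ.image x.color

/-- The set of colours that a family of coloured ordered graphs shows. -/
def familyColors (A : Finset (ColoredGraph n α)) : Finset α :=
  A.biUnion colors

theorem color_mem_colors (x : ColoredGraph n α) (v : Fin n) : x.color v ∈ x.colors :=
  mem_image_of_mem _ (mem_univ v)

theorem mem_colors {x : ColoredGraph n α} {a : α} : a ∈ x.colors ↔ ∃ v, x.color v = a := by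
  simp [colors]

theorem colors_subset_familyColors {A : Finset (ColoredGraph n α)} {x : ColoredGraph n α}
    (hx : x ∈ A) : x.colors ⊆ familyColors A :=
  subset_biUnion_of_mem colors hx

theorem familyColors_insert (x : ColoredGraph n α) (A : Finset (ColoredGraph n α)) :
    familyColors (insert x A) = x.colors ∪ familyColors A :=
  biUnion_insert

theorem injOn_map_of_injOn_familyColors {A : Finset (ColoredGraph n α)} {f : α → β}
    (hf : Set.InjOn f (familyColors A)) : Set.InjOn (map f) (A : Set (ColoredGraph n α)) := by
  intro x hx y hy hxy
  obtain ⟨hcolor, hgraph⟩ := ColoredGraph.mk.inj hxy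
  refine ColoredGraph.ext (funext fun v => ?_) hgraph
  exact hf (colors_subset_familyColors hx (x.color_mem_colors v))
    (colors_subset_familyColors hy (y.color_mem_colors v)) (congrFun hcolor v)

theorem colors_deleteVertex_subset (x : ColoredGraph (n + 1) α) (v : Fin (n + 1)) :
    (x.deleteVertex v).colors ⊆ x.colors := by
  simp only [subset_iff, mem_colors]
  rintro _ ⟨i, rfl⟩
  exact ⟨v.succAbove i, rfl⟩

theorem color_mem_colors_deleteVertex (x : ColoredGraph (n + 1) α) {v w : Fin (n + 1)}
    (h : v ≠ w) : x.color v ∈ (x.deleteVertex w).colors := by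
  obtain ⟨i, rfl⟩ := Fin.exists_succAbove_eq h
  exact mem_colors.2 ⟨i, rfl⟩

theorem card_colors_sdiff_le_card_filter_shadow (x : ColoredGraph (n + 2) α) (Q : Finset α) :
    #(x.colors \ Q) ≤ #{y ∈ x.shadow | ¬y.colors ⊆ Q} := by
  have deleteVertex_mem {v w : Fin (n + 2)} (hvw : v ≠ w) (hv : x.color v ∉ Q) :
      x.deleteVertex w ∈ {y ∈ x.shadow | ¬y.colors ⊆ Q} :=
    mem_filter.2 ⟨mem_image_of_mem _ (mem_univ w),
      fun hQ => hv (hQ (x.color_mem_colors_deleteVertex hvw))⟩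
  have exists_vertex : ∀ a ∈ x.colors \ Q, ∃ v, x.color v = a := fun a ha =>
    mem_colors.1 (mem_sdiff.1 ha).1
  choose! v hv using exists_vertex
  have color_notMem : ∀ a ∈ x.colors \ Q, x.color (v a) ∉ Q := fun a ha => by
    rw [hv a ha]
    exact (mem_sdiff.1 ha).2
  rcases (x.colors \ Q).eq_empty_or_nonempty with hempty | ⟨a, ha⟩
  · simp [hempty]
  by_cases hR : (x.colors \ Q).Nontrivial
  · refine card_le_card_of_injOn (fun a => x.deleteVertex (v a)) (fun a ha => ?_) ?_
    · obtain ⟨b, hb, hba⟩ := hR.exists_ne a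
      refine deleteVertex_mem (fun h => hba ?_) (color_notMem b hb)
      rw [← hv a ha, ← hv b hb, h]
    · intro a ha b hb hab
      rw [← hv a ha, ← hv b hb, x.color_eq_of_deleteVertex_eq hab]
  · obtain ⟨w, hw⟩ := exists_ne (v a)
    calc #(x.colors \ Q) ≤ 1 := not_lt.1 (mt one_lt_card_iff_nontrivial.1 hR)
      _ ≤ #{y ∈ x.shadow | ¬y.colors ⊆ Q} :=
        card_pos.2 ⟨_, deleteVertex_mem hw.symm (color_notMem a ha)⟩

theorem familyColors_familyShadow_subset (A : Finset (ColoredGraph (n + 1) α)) :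
    familyColors (familyShadow A) ⊆ familyColors A := by
  refine biUnion_subset.2 fun y hy => ?_
  obtain ⟨x, hx, v, rfl⟩ := mem_familyShadow.1 hy
  exact (x.colors_deleteVertex_subset v).trans (colors_subset_familyColors hx)

theorem card_familyShadow_add_card_colors_sdiff_le (A : Finset (ColoredGraph (n + 2) α))
    (x : ColoredGraph (n + 2) α) :
    #(familyShadow A) + #(x.colors \ familyColors A) ≤ #(familyShadow (insert x A)) := by
  have hdisj : Disjoint (familyShadow A) {y ∈ x.shadow | ¬y.colors ⊆ familyColors A} :=
    disjoint_left.2 fun y hyA hyx => (mem_filter.1 hyx).2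
      ((colors_subset_familyColors hyA).trans (familyColors_familyShadow_subset A))
  calc #(familyShadow A) + #(x.colors \ familyColors A)
      ≤ #(familyShadow A) + #{y ∈ x.shadow | ¬y.colors ⊆ familyColors A} := by
        gcongr
        exact x.card_colors_sdiff_le_card_filter_shadow _
    _ = #(familyShadow A ∪ {y ∈ x.shadow | ¬y.colors ⊆ familyColors A}) :=
        (card_union_of_disjoint hdisj).symm
    _ ≤ #(familyShadow (insert x A)) := by
        rw [familyShadow, familyShadow, biUnion_insert, union_comm]
        exact card_le_card (union_subset_union_left (filter_subset _ _))

theorem monotone_card_familyShadow_sub_card_familyColors :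
    Monotone fun A : Finset (ColoredGraph (n + 2) α) =>
      (#(familyShadow A) : ℤ) - #(familyColors A) := by
  refine Finset.monotone_iff_forall_le_insert.2 fun A x _ => ?_
  have hshadow := card_familyShadow_add_card_colors_sdiff_le A x
  have hcolors : #(familyColors (insert x A)) =
      #(x.colors \ familyColors A) + #(familyColors A) := by
    rw [familyColors_insert, card_sdiff_add_card]
  omega

theorem add_card_familyColors_le_of_subset {m : ℕ} {A B : Finset (ColoredGraph (n + 2) α)}
    (hAB : A ⊆ B) (hA : m + #(familyColors A) ≤ #(familyShadow A)) :
    m + #(familyColors B) ≤ #(familyShadow B) := by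
  have hmono := monotone_card_familyShadow_sub_card_familyColors hAB
  dsimp only at hmono
  omega

/-- The graphs `x.init` of the members `x` of `A` whose last vertex has colour `c`. -/
def link (A : Finset (ColoredGraph (n + 1) α)) (c : α) : Finset (ColoredGraph n (α × Bool)) :=
  image init {x ∈ A | x.lastColor = c}

theorem card_link (A : Finset (ColoredGraph (n + 1) α)) (c : α) :
    #(link A c) = #{x ∈ A | x.lastColor = c} :=
  card_image_of_injOn fun _ hx _ hy hxy =>
    eq_of_lastColor_eq_of_init_eq ((mem_filter.1 hx).2.trans (mem_filter.1 hy).2.symm) hxy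

theorem sum_card_link {A : Finset (ColoredGraph (n + 1) α)} {s : Finset α}
    (hs : familyColors A ⊆ s) : ∑ c ∈ s, #(link A c) = #A := by
  simp only [card_link]
  exact (card_eq_sum_card_fiberwise fun x hx =>
    hs (colors_subset_familyColors hx (x.color_mem_colors _))).symm

theorem link_filter (A : Finset (ColoredGraph (n + 1) α)) (c : α) :
    link {x ∈ A | x.lastColor = c} c = link A c := by
  simp [link, filter_filter]

theorem familyShadow_link_subset (A : Finset (ColoredGraph (n + 2) α)) (c : α) :
    familyShadow (link A c) ⊆ link (familyShadow A) c := by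
  intro y hy
  simp only [link, mem_familyShadow, mem_image, mem_filter] at hy
  obtain ⟨_, ⟨x, ⟨hx, rfl⟩, rfl⟩, v, rfl⟩ := hy
  rw [← init_deleteVertex_castSucc]
  exact mem_image_of_mem _ (mem_filter.2
    ⟨deleteVertex_mem_familyShadow hx _, x.lastColor_deleteVertex_castSucc v⟩)

theorem card_familyShadow_link_le (A : Finset (ColoredGraph (n + 2) α)) (c : α) :
    #(familyShadow (link A c)) ≤ #{y ∈ familyShadow A | y.lastColor = c} :=
  (card_le_card (familyShadow_link_subset A c)).trans_eq (card_link _ _)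

theorem sum_card_familyShadow_link_le (A : Finset (ColoredGraph (n + 2) α)) :
    ∑ c ∈ familyColors A, #(familyShadow (link A c)) ≤ #(familyShadow A) :=
  calc ∑ c ∈ familyColors A, #(familyShadow (link A c))
      ≤ ∑ c ∈ familyColors A, #(link (familyShadow A) c) :=
        sum_le_sum fun c _ => card_le_card (familyShadow_link_subset A c)
    _ = #(familyShadow A) := sum_card_link (familyColors_familyShadow_subset A)

theorem image_map_fst_link_subset (A : Finset (ColoredGraph (n + 1) α)) (c : α) :
    (link A c).image (map Prod.fst) ⊆ familyShadow A := by
  simp only [link, subset_iff, mem_image, mem_filter]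
  rintro _ ⟨_, ⟨x, ⟨hx, -⟩, rfl⟩, rfl⟩
  rw [map_fst_init]
  exact deleteVertex_mem_familyShadow hx _

variable [DecidableEq β]

theorem lastColor_map_mem {F : Finset (ColoredGraph (n + 1) α)} (f : α → β)
    {w : ColoredGraph (n + 1) α} (hw : w ∈ F) :
    (w.map f).lastColor ∈ (familyColors F).image f :=
  mem_image_of_mem f (colors_subset_familyColors hw (w.color_mem_colors _))

theorem familyColors_subset_insert {A : Finset (ColoredGraph (n + 1) α)} {c : α}
    (hA : ∀ x ∈ A, x.lastColor = c) :
    familyColors A ⊆ insert c ((familyColors (link A c)).image Prod.fst) := by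
  refine biUnion_subset.2 fun x hx a ha => ?_
  obtain ⟨v, rfl⟩ := mem_colors.1 ha
  cases v using Fin.lastCases with
  | last => exact mem_insert.2 (Or.inl (hA x hx))
  | cast i =>
    have hinit : x.init ∈ link A c := mem_image_of_mem _ (mem_filter.2 ⟨hx, hA x hx⟩)
    exact mem_insert_of_mem (mem_image_of_mem Prod.fst
      (colors_subset_familyColors hinit (x.init.color_mem_colors i)))

theorem card_image_map_fst_link_add_le (A : Finset (ColoredGraph (n + 2) α)) {c : α}
    (hc : c ∉ (familyColors (link A c)).image Prod.fst) :
    #((link A c).image (map Prod.fst)) + #(familyShadow (link A c)) ≤ #(familyShadow A) := by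
  have hne : (link A c).image (map Prod.fst) ⊆ {y ∈ familyShadow A | y.lastColor ≠ c} := by
    refine fun y hy => mem_filter.2 ⟨image_map_fst_link_subset A c hy, ?_⟩
    obtain ⟨w, hw, rfl⟩ := mem_image.1 hy
    exact ne_of_mem_of_not_mem (lastColor_map_mem Prod.fst hw) hc
  calc #((link A c).image (map Prod.fst)) + #(familyShadow (link A c))
      ≤ #{y ∈ familyShadow A | y.lastColor ≠ c} + #{y ∈ familyShadow A | y.lastColor = c} :=
        add_le_add (card_le_card hne) (card_familyShadow_link_le A c)
    _ = #(familyShadow A) := by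
        rw [add_comm]
        exact card_filter_add_card_filter_not _

/-- Either the recolouring loses a colour, which the bound on the shadow makes up for, or it is
injective on the family. -/
theorem lt_card_image_map_or_lt_card_familyShadow {k : ℕ} {F : Finset (ColoredGraph (n + 1) α)}
    (f : α → β) (hF : k + #(familyColors F) < #F)
    (hshadow : k + #(familyColors F) ≤ #(familyShadow F)) :
    k + #((familyColors F).image f) < #(F.image (map f)) ∨
      k + #((familyColors F).image f) < #(familyShadow F) := by
  rcases (card_image_le (s := familyColors F) (f := f)).lt_or_eq with hlt | heq
  · exact Or.inr (by omega)
  · have hinj := injOn_map_of_injOn_familyColors (card_image_iff.1 heq)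
    left
    rwa [heq, card_image_of_injOn hinj]

theorem add_card_familyColors_le_of_lastColor_eq {k : ℕ} {A : Finset (ColoredGraph (n + 2) α)}
    {c : α} (hA : ∀ x ∈ A, x.lastColor = c)
    (hlink : k + #(familyColors (link A c)) < #(link A c))
    (hshadow : k + #(familyColors (link A c)) ≤ #(familyShadow (link A c))) :
    k + 1 + #(familyColors A) ≤ #(familyShadow A) := by
  have hcolors := card_le_card (familyColors_subset_insert hA)
  have hlast := card_le_card (image_map_fst_link_subset A c)
  have hother := (card_familyShadow_link_le A c).trans (card_filter_le _ _)
  have hlt := lt_card_image_map_or_lt_card_familyShadow Prod.fst hlink hshadow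
  by_cases hc : c ∈ (familyColors (link A c)).image Prod.fst
  · rw [insert_eq_of_mem hc] at hcolors
    omega
  · rw [card_insert_of_notMem hc] at hcolors
    have hadd := card_image_map_fst_link_add_le A hc
    have hne : (link A c).Nonempty := card_pos.1 (by omega)
    have hlast_pos := (hne.image (map Prod.fst)).card_pos
    have hother_pos := (familyShadow_nonempty hne).card_pos
    omega

theorem min_card_le_card_familyShadow (k : ℕ) (A : Finset (ColoredGraph (k + 2) α)) :
    min #A (k + #(familyColors A)) ≤ #(familyShadow A) := by
  induction k generalizing α with
  | zero =>
    exact (min_le_right _ _).trans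
      (add_card_familyColors_le_of_subset (empty_subset A) (by simp [familyColors]))
  | succ k ih =>
    by_cases hsmall : ∀ c ∈ familyColors A, #(link A c) ≤ k + #(familyColors (link A c))
    · refine (min_le_left _ _).trans ?_
      calc #A = ∑ c ∈ familyColors A, #(link A c) := (sum_card_link Subset.rfl).symm
        _ ≤ ∑ c ∈ familyColors A, #(familyShadow (link A c)) :=
            sum_le_sum fun c hc => (min_eq_left (hsmall c hc)).symm.trans_le (ih (link A c))
        _ ≤ #(familyShadow A) := sum_card_familyShadow_link_le A
    · push Not at hsmall
      obtain ⟨c, -, hc⟩ := hsmall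
      refine (min_le_right _ _).trans (add_card_familyColors_le_of_subset
        (filter_subset (fun x => x.lastColor = c) A) ?_)
      refine add_card_familyColors_le_of_lastColor_eq (c := c) (fun x hx => (mem_filter.1 hx).2)
        ?_ ?_
      · rwa [link_filter]
      · rw [link_filter]
        exact (min_eq_right hc.le).symm.trans_le (ih (link A c))

/-- An ordered graph as a coloured ordered graph with a single colour. -/
def ofOrderedGraph (G : OrderedGraph n) : ColoredGraph n Unit where
  color _ := ()
  graph := G

theorem ofOrderedGraph_injective :
    Function.Injective (ofOrderedGraph : OrderedGraph n → ColoredGraph n Unit) :=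
  fun _ _ h => congrArg graph h

theorem ofOrderedGraph_deleteVertex (G : OrderedGraph (n + 1)) (v : Fin (n + 1)) :
    ofOrderedGraph (G.deleteVertex v) = (ofOrderedGraph G).deleteVertex v := by
  have h : v.succAboveOrderEmb = (univ.erase v).orderEmbOfFin (OrderedGraph.card_erase_vertex v) :=
    orderEmbOfFin_unique' _ fun i => by simp [Fin.succAbove_ne]
  refine ColoredGraph.ext rfl ?_
  change G.comap ((univ.erase v).orderEmbOfFin (OrderedGraph.card_erase_vertex v)) = _
  rw [← h]
  rfl

theorem coe_familyShadow_image_ofOrderedGraph (𝒢 : Finset (OrderedGraph (n + 1))) :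
    (familyShadow (𝒢.image ofOrderedGraph) : Set (ColoredGraph n Unit)) =
      ofOrderedGraph '' OrderedGraph.familyShadow (𝒢 : Set (OrderedGraph (n + 1))) := by
  ext y
  simp only [mem_coe, mem_familyShadow, mem_image, OrderedGraph.familyShadow, OrderedGraph.shadow,
    Set.mem_image, Set.mem_iUnion, Set.mem_ofPred_eq]
  constructor
  · rintro ⟨_, ⟨G, hG, rfl⟩, v, rfl⟩
    exact ⟨_, ⟨G, hG, v, rfl⟩, ofOrderedGraph_deleteVertex G v⟩
  · rintro ⟨_, ⟨G, hG, v, rfl⟩, rfl⟩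
    exact ⟨_, ⟨G, hG, rfl⟩, v, (ofOrderedGraph_deleteVertex G v).symm⟩

theorem card_familyShadow_image_ofOrderedGraph (𝒢 : Finset (OrderedGraph (n + 1))) :
    #(familyShadow (𝒢.image ofOrderedGraph)) =
      (OrderedGraph.familyShadow (𝒢 : Set (OrderedGraph (n + 1)))).ncard := by
  rw [← Set.ncard_coe_finset, coe_familyShadow_image_ofOrderedGraph]
  exact Set.ncard_image_of_injective _ ofOrderedGraph_injective

theorem card_familyColors_image_ofOrderedGraph_pos {𝒢 : Finset (OrderedGraph (n + 1))}
    (h𝒢 : 𝒢.Nonempty) : 0 < #(familyColors (𝒢.image ofOrderedGraph)) :=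
  h𝒢.elim fun G hG => card_pos.2 ⟨(), colors_subset_familyColors (mem_image_of_mem _ hG)
    ((ofOrderedGraph G).color_mem_colors 0)⟩

end

end ColoredGraph

theorem theorem1_general (n : ℕ) (𝒢 : Set (OrderedGraph n)) :
    min 𝒢.ncard (n - 1) ≤ (OrderedGraph.familyShadow 𝒢).ncard := by
  obtain hn | ⟨k, rfl⟩ : n - 1 = 0 ∨ ∃ k, n = k + 2 := by
    rcases n with _ | _ | k <;> simp
  · simp [hn]
  lift 𝒢 to Finset (OrderedGraph (k + 2)) using 𝒢.toFinite
  rcases 𝒢.eq_empty_or_nonempty with rfl | h𝒢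
  · simp
  have hmin := ColoredGraph.min_card_le_card_familyShadow k (𝒢.image ColoredGraph.ofOrderedGraph)
  rw [Finset.card_image_of_injective _ ColoredGraph.ofOrderedGraph_injective] at hmin
  have hcolors := ColoredGraph.card_familyColors_image_ofOrderedGraph_pos h𝒢
  rw [Set.ncard_coe_finset, ← ColoredGraph.card_familyShadow_image_ofOrderedGraph]
  omega

theorem theorem1 (n : ℕ) (hn : 136 ≤ n) (𝒢 : Set (OrderedGraph n)) (h𝒢 : 𝒢.ncard < n) :
    𝒢.ncard ≤ (OrderedGraph.familyShadow 𝒢).ncard := by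
  have hmin := theorem1_general n 𝒢
  rwa [min_eq_left (Nat.le_sub_one_of_lt h𝒢)] at hmin
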